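/- Let $n\ge 0$, let $\mathcal O(\mathbb R^n)$ be the ring of real analytic functions $\mathbb R^n\to\mathbb R$, and let $b,f\in\mathcal O(\mathbb R^n)$ be non-constant. Let $\Omega$ be an open neighbourhood of $\mathbb R^n$ in $\mathbb C^n$, invariant under complex conjugation, to which $b$ and $f$ extend as holomorphic functions $B,F:\Omega\to\mathbb C$. Let $Z\subset\Omega$ be a complex analytic subset of $\Omega$ (that is, each point of $\Omega$ has an open neighbourhood in $\Omega$ in which $Z$ is the set of common zeros of finitely many holomorphic functions), and let $x_0\in\mathbb R^n$ with $f(x_0)=0$ be such that the germ inclusion $Z_{x_0}\subset\mathcal Z(F)_{x_0}$ fails, where $\mathcal Z(F)=\{z\in\Omega: F(z)=0\}$. Then there exists an analytic diffeomorphism $\varphi:\mathbb R^n\to\mathbb R^n$ (a bijection that is real analytic together with its inverse) such that: (i) $f\circ\varphi=f\,u$ for some unit $u$ of the ring $\mathcal O(\mathbb R^n)$; (ii) there are an open neighbourhood $\Omega_0\subset\Omega$ of $\mathbb R^n$ in $\mathbb C^n$ and a holomorphic function $B_0:\Omega_0\to\mathbb C$ extending $b_0:=b\circ\varphi$ such that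 the germ inclusion $Z_{x_0}\subset\mathcal Z(B_0)_{x_0}$ fails, where $\mathcal Z(B_0)=\{z\in\Omega_0:B_0(z)=0\}$. -/

import Mathlib

open Set Filter Topology

namespace PerturbDenominators

/-- The real coordinate space `ℝⁿ`. -/
abbrev RSpace (n : ℕ) : Type := Fin n → ℝ

/-- The complex coordinate space `ℂⁿ`. -/
abbrev CSpace (n : ℕ) : Type := Fin n → ℂ

/-- The standard inclusion `ℝⁿ ⊂ ℂⁿ`. -/
def toC {n : ℕ} (x : RSpace n) : CSpace n := fun i => (x i : ℂ)

/-- The coordinatewise complex conjugation `σ : ℂⁿ → ℂⁿ`. -/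
def conjC {n : ℕ} (z : CSpace n) : CSpace n := fun i => (starRingEnd ℂ) (z i)

/-- A subset `A ⊂ ℂⁿ` is invariant if `σ(A) = A`. -/
def IsInvariant {n : ℕ} (A : Set (CSpace n)) : Prop := conjC '' A = A

/-- `U` is an open neighbourhood of `ℝⁿ` in `ℂⁿ`. -/
def IsOpenNhdOfReal {n : ℕ} (U : Set (CSpace n)) : Prop :=
  IsOpen U ∧ Set.range (toC : RSpace n → CSpace n) ⊆ U

/-- The ring `𝒪(ℝⁿ)` of real analytic functions on `ℝⁿ`, with pointwise operations. -/
def AnalyticRing (n : ℕ) : Subring (RSpace n → ℝ) where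
  carrier := {f | AnalyticOnNhd ℝ f Set.univ}
  mul_mem' hf hg := AnalyticOnNhd.mul hf hg
  one_mem' := analyticOnNhd_const
  add_mem' hf hg := AnalyticOnNhd.add hf hg
  zero_mem' := analyticOnNhd_const
  neg_mem' hf := AnalyticOnNhd.neg hf

/-- `g : ℝⁿ → ℝ` is non-constant. -/
def NonConstant {n : ℕ} (g : RSpace n → ℝ) : Prop := ¬ ∃ c : ℝ, ∀ x, g x = c

/-- `G` is holomorphic on `U` (complex analytic at each point of `U`) and restricts to `g`
on `ℝⁿ`. The values of `G` outside `U` play no role. -/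
def IsHolomorphicExtension {n : ℕ} (g : RSpace n → ℝ) (U : Set (CSpace n))
    (G : CSpace n → ℂ) : Prop :=
  IsOpenNhdOfReal U ∧ AnalyticOnNhd ℂ G U ∧ ∀ x : RSpace n, G (toC x) = (g x : ℂ)

/-- The zero set in `U` of a function `G` defined on `U`. -/
def zeroSet {n : ℕ} (U : Set (CSpace n)) (G : CSpace n → ℂ) : Set (CSpace n) :=
  {z | z ∈ U ∧ G z = 0}

/-- `Z` is a complex analytic subset of the open set `U`: near each point of `U` it is the set of
common zeros of finitely many holomorphic functions. -/
def IsComplexAnalyticSet {n : ℕ} (U Z : Set (CSpace n)) : Prop :=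
  Z ⊆ U ∧ ∀ p ∈ U, ∃ V : Set (CSpace n), IsOpen V ∧ p ∈ V ∧ V ⊆ U ∧
    ∃ (k : ℕ) (g : Fin k → CSpace n → ℂ), (∀ j, AnalyticOnNhd ℂ (g j) V) ∧
      Z ∩ V = {z | z ∈ V ∧ ∀ j, g j z = 0}

/-- Inclusion of set germs `A_p ⊂ A'_p`. -/
def GermSubset {n : ℕ} (p : CSpace n) (A A' : Set (CSpace n)) : Prop :=
  ∃ V ∈ 𝓝 p, A ∩ V ⊆ A' ∩ V

end PerturbDenominators

open PerturbDenominators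

/-! Since `b` is not constant, it is not constant on some line through `x₀`; let `v` be its
direction. Take an analytic `S` with entire extension and `∂ᵥS ≥ 1 + 2|∂ᵥf|`
(`exists_entire_le_fderiv`). For `t ∈ [0,1]`, both `S` and `S + t f` increase from `-∞` to `∞` along
every line parallel to `v`, so each can replace the linear coordinate `l` with `l v = 1`
(`bijective_shear`). Comparing the two coordinate systems gives an analytic diffeomorphism `φ` that
moves points along `v` and satisfies `S ∘ φ = S + t f`.

Writing `φ x = x + σ x • v`, difference quotients give `f ∘ φ - f = σ P` and `t f = σ Q` with `1 +
2|P| ≤ Q`. Hence `f ∘ φ = f (1 + t P / Q)`, and the factor is a unit (`exists_unit_of_shear`).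

It remains to choose `t`. Pick `z k ∈ Z` tending to `x₀` with `F (z k) ≠ 0`. In the coordinate `S`,
the extension of `b ∘ φ` at `z k` is `G (w k + t F (z k) v)`, where `G` is `B` in that coordinate
and does not vanish identically along `v`. For large `k` this has finitely many zeros `t ∈ [0,1]`,
so some `t` avoids them all (`exists_param_ne_zero`). -/

/-! ### Joint analyticity of difference quotients -/

section Hadamard

variable {𝕜 E F : Type*} [NontriviallyNormedField 𝕜] [NormedAddCommGroup E] [NormedSpace 𝕜 E]
  [NormedAddCommGroup F] [NormedSpace 𝕜 F]

/-- Telescoping expansion of the difference of two diagonal values of a multilinear map. -/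
theorem ContinuousMultilinearMap.map_const_add_smul_sub {n : ℕ}
    (p : ContinuousMultilinearMap 𝕜 (fun _ : Fin (n + 1) => E) F) (a b v : E) (s : 𝕜)
    (hab : a = b + s • v) :
    p (fun _ => a) - p (fun _ => b) =
      s • ∑ i : Fin (n + 1), p (i.insertNth v (fun j : Fin n => if j.castSucc < i then a else b)) := by
  -- Hybrids with `a` in the first `k` slots and `b` in the others: consecutive ones differ in a
  -- single slot, by `a - b = s • v`.
  set g : ℕ → F := fun k => p (fun j : Fin (n + 1) => if (j : ℕ) < k then a else b) with hg
  have h1 : p (fun _ => a) = g (n + 1) := by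
    simp only [hg, Fin.is_lt, if_true]
  have h0 : p (fun _ => b) = g 0 := by simp [hg]
  rw [h1, h0, ← Finset.sum_range_sub, Finset.smul_sum, Finset.sum_range]
  refine Finset.sum_congr rfl fun i _ => ?_
  have hu : ∀ w : E, (i.insertNth w (fun j : Fin n => if j.castSucc < i then a else b) :
      Fin (n + 1) → E) =
      Function.update (fun j : Fin (n + 1) => if j < i then a else b) i w := by
    intro w
    rw [Fin.insertNth_eq_iff]
    refine ⟨by simp, ?_⟩
    ext j
    simp only [Fin.removeNth, Function.update_of_ne (Fin.succAbove_ne i j)]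
    congr 1
    simp only [eq_iff_iff]
    exact (Fin.succAbove_lt_iff_castSucc_lt i j).symm
  have ha : g (i + 1) = p (Function.update (fun j : Fin (n + 1) => if j < i then a else b) i a) := by
    simp only [hg]
    congr 1
    ext j
    rcases eq_or_ne j i with rfl | hj
    · simp
    · rw [Function.update_of_ne hj]
      have : ((j : ℕ) < i + 1) ↔ j < i := by
        have := Fin.val_ne_of_ne hj
        rw [Fin.lt_def]; omega
      simp only [this]
  have hb : g i = p (Function.update (fun j : Fin (n + 1) => if j < i then a else b) i b) := by
    simp only [hg]
    congr 1
    ext j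
    rcases eq_or_ne j i with rfl | hj
    · simp
    · rw [Function.update_of_ne hj]
      simp only [Fin.lt_def]
  rw [hu, ha, hb, ← p.map_update_sub, hab, add_sub_cancel_left, p.map_update_smul]

/-- The power series of the difference quotient `(y, s) ↦ s⁻¹ • (f (y + s • v) - f y)`. -/
noncomputable def FormalMultilinearSeries.diffQuotient (p : FormalMultilinearSeries 𝕜 E F) (v : E) :
    FormalMultilinearSeries 𝕜 (E × 𝕜) F := fun n =>
  ∑ i : Fin (n + 1), ((p (n + 1)).curryMid i v).compContinuousLinearMap
    (fun j : Fin n => if j.castSucc < i then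
      ContinuousLinearMap.fst 𝕜 E 𝕜 + (ContinuousLinearMap.snd 𝕜 E 𝕜).smulRight v
      else ContinuousLinearMap.fst 𝕜 E 𝕜)

theorem FormalMultilinearSeries.smul_diffQuotient_apply (p : FormalMultilinearSeries 𝕜 E F) (v : E)
    (n : ℕ) (y : E) (s : 𝕜) :
    s • p.diffQuotient v n (fun _ => (y, s)) =
      p (n + 1) (fun _ => y + s • v) - p (n + 1) (fun _ => y) := by
  rw [(p (n + 1)).map_const_add_smul_sub (y + s • v) y v s rfl]
  simp only [diffQuotient, _root_.sum_apply,
    ContinuousMultilinearMap.compContinuousLinearMap_apply, ContinuousMultilinearMap.curryMid_apply]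
  congr 1
  refine Finset.sum_congr rfl fun i _ => ?_
  congr 2
  ext j
  split_ifs <;> simp

theorem FormalMultilinearSeries.norm_diffQuotient_le (p : FormalMultilinearSeries 𝕜 E F) (v : E) :
    ∃ K : ℝ, 0 < K ∧ ∀ n, ‖p.diffQuotient v n‖ ≤ (n + 1) * (‖p (n + 1)‖ * ‖v‖ * K ^ n) := by
  set A := ContinuousLinearMap.fst 𝕜 E 𝕜 + (ContinuousLinearMap.snd 𝕜 E 𝕜).smulRight v with hA
  set B := ContinuousLinearMap.fst 𝕜 E 𝕜 with hB
  refine ⟨‖A‖ + ‖B‖ + 1, by positivity, fun n => ?_⟩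
  have : ∀ i : Fin (n + 1), ‖((p (n + 1)).curryMid i v).compContinuousLinearMap
      (fun j : Fin n => if j.castSucc < i then A else B)‖ ≤
      ‖p (n + 1)‖ * ‖v‖ * (‖A‖ + ‖B‖ + 1) ^ n := by
    intro i
    refine (ContinuousMultilinearMap.norm_compContinuousLinearMap_le _ _).trans ?_
    gcongr
    · refine (ContinuousLinearMap.le_opNorm _ _).trans ?_
      rw [ContinuousMultilinearMap.norm_curryMid]
    · refine (Finset.prod_le_prod (g := fun _ => ‖A‖ + ‖B‖ + 1) (fun j _ => norm_nonneg _)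
        fun j _ => ?_).trans ?_
      · split_ifs
        · linarith [norm_nonneg B]
        · linarith [norm_nonneg A]
      · simp
  refine (norm_sum_le _ _).trans ((Finset.sum_le_sum fun i _ => this i).trans ?_)
  simp

theorem FormalMultilinearSeries.diffQuotient_radius_pos (p : FormalMultilinearSeries 𝕜 E F) (v : E)
    (hp : 0 < p.radius) : 0 < (p.diffQuotient v).radius := by
  obtain ⟨a, ha0, ha⟩ := ENNReal.lt_iff_exists_nnreal_btwn.1 hp
  have ha0' : 0 < (a : ℝ) := by exact_mod_cast ha0
  obtain ⟨C, hC, hCb⟩ := p.norm_mul_pow_le_of_lt_radius ha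
  obtain ⟨K, hK, hKb⟩ := p.norm_diffQuotient_le v
  -- The `K` cancels `K ^ n`, and the `2` absorbs the factor `n + 1 ≤ 2 ^ n`.
  let r : NNReal := ⟨a / (2 * K), by positivity⟩
  have hr : (r : ℝ) = a / (2 * K) := rfl
  have hr0 : 0 < r := by
    rw [← NNReal.coe_pos, hr]; positivity
  refine lt_of_lt_of_le (ENNReal.coe_pos.2 hr0)
    ((p.diffQuotient v).le_radius_of_bound (C * ‖v‖ / a) fun n => ?_)
  have h2 : ((n : ℝ) + 1) ≤ 2 ^ n := by
    exact_mod_cast Nat.succ_le_of_lt (Nat.lt_two_pow_self (n := n))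
  calc ‖p.diffQuotient v n‖ * (r : ℝ) ^ n
      ≤ (2 ^ n * (‖p (n + 1)‖ * ‖v‖ * K ^ n)) * (r : ℝ) ^ n := by
        gcongr
        exact (hKb n).trans (by gcongr)
    _ = (‖p (n + 1)‖ * (a : ℝ) ^ (n + 1)) * ‖v‖ / a := by
        rw [hr, div_pow, mul_pow, pow_succ]; field_simp
    _ ≤ C * ‖v‖ / a := by gcongr; exact hCb _

variable [CompleteSpace F]

/-- The difference quotient of an analytic function in a fixed direction extends analytically. -/
theorem AnalyticAt.exists_diffQuotient {f : E → F} {x : E} (hf : AnalyticAt 𝕜 f x) (v : E) :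
    ∃ Q : E × 𝕜 → F, AnalyticAt 𝕜 Q (x, 0) ∧
      ∀ᶠ p in 𝓝 (x, (0 : 𝕜)), f (p.1 + p.2 • v) - f p.1 = p.2 • Q p := by
  obtain ⟨p, r, hp⟩ := hf
  have hq := (p.diffQuotient v).hasFPowerSeriesOnBall
    (p.diffQuotient_radius_pos v (hp.r_pos.trans_le hp.r_le))
  have hq' : HasFPowerSeriesOnBall (fun w : E × 𝕜 => (p.diffQuotient v).sum (w - (x, 0)))
      (p.diffQuotient v) (x, 0) (p.diffQuotient v).radius := by
    simpa using hq.comp_sub (x, 0)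
  refine ⟨_, hq'.analyticAt, ?_⟩
  have c1 : Tendsto (fun w : E × 𝕜 => w - (x, 0)) (𝓝 (x, 0)) (𝓝 0) := by
    have : ContinuousAt (fun w : E × 𝕜 => w - (x, 0)) (x, 0) := by fun_prop
    simpa [ContinuousAt] using this
  have c2 : Tendsto (fun w : E × 𝕜 => w.1 - x) (𝓝 (x, 0)) (𝓝 0) := by
    have : ContinuousAt (fun w : E × 𝕜 => w.1 - x) (x, 0) := by fun_prop
    simpa [ContinuousAt] using this
  have c3 : Tendsto (fun w : E × 𝕜 => w.1 - x + w.2 • v) (𝓝 (x, 0)) (𝓝 0) := by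
    have : ContinuousAt (fun w : E × 𝕜 => w.1 - x + w.2 • v) (x, 0) := by fun_prop
    simpa [ContinuousAt] using this
  filter_upwards [c1 (Metric.eball_mem_nhds _ hq.r_pos), c2 (Metric.eball_mem_nhds _ hp.r_pos),
    c3 (Metric.eball_mem_nhds _ hp.r_pos)] with w h1 h2 h3
  simp only [mem_preimage] at h1 h2 h3
  have s1 := (hq.hasSum h1).const_smul w.2
  have s2 := (hp.hasSum h3).sub (hp.hasSum h2)
  have e1 : x + (w.1 - x + w.2 • v) = w.1 + w.2 • v := by abel
  have e2 : x + (w.1 - x) = w.1 := by abel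
  -- The constant terms cancel; dropping them aligns degree `n + 1` of `p` with degree `n` of the
  -- quotient.
  rw [e1, e2, ← hasSum_nat_add_iff' 1] at s2
  have hw : w - (x, 0) = (w.1 - x, w.2) := by ext <;> simp
  rw [zero_add, hw] at s1
  rw [hw]
  simp only [FormalMultilinearSeries.smul_diffQuotient_apply] at s1
  have z : (p 0 fun _ => w.1 - x + w.2 • v) - (p 0 fun _ => w.1 - x) = 0 := by
    rw [sub_eq_zero]; congr 1; ext i; exact i.elim0
  simp only [Finset.range_one, Finset.sum_singleton, z, sub_zero] at s2
  exact s2.unique s1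

/-- The difference quotient of an analytic function along a direction, extended by the directional
derivative, is jointly analytic. -/
theorem AnalyticOnNhd.dslope_line {f : E → F} (hf : AnalyticOnNhd 𝕜 f univ) (v : E) :
    AnalyticOnNhd 𝕜 (fun p : E × 𝕜 => dslope (fun s => f (p.1 + s • v)) 0 p.2) univ := by
  rintro ⟨x, s⟩ -
  rcases eq_or_ne s 0 with rfl | hs
  · obtain ⟨Q, hQ, hQe⟩ := (hf x (mem_univ x)).exists_diffQuotient v
    refine hQ.congr ?_
    -- At nearby points `(y, 0)` the value is a derivative, so the identity for `Q` is needed on a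
    -- whole neighbourhood of them.
    filter_upwards [hQe.eventually_nhds, hQ.eventually_analyticAt] with ⟨y, t⟩ h1 h2
    rcases eq_or_ne t 0 with rfl | ht
    · rw [dslope_same]
      have hc : Tendsto (fun t : 𝕜 => (y, t)) (𝓝 0) (𝓝 (y, 0)) :=
        Continuous.tendsto (by fun_prop) _
      have h3 : (fun t : 𝕜 => f (y + t • v)) =ᶠ[𝓝 0] fun t => f y + t • Q (y, t) := by
        filter_upwards [hc.eventually h1] with t ht
        rw [← ht]; simp
      rw [h3.deriv_eq]
      have hd : DifferentiableAt 𝕜 (fun t : 𝕜 => Q (y, t)) 0 :=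
        h2.differentiableAt.comp (0 : 𝕜) (by fun_prop)
      have := ((hasDerivAt_id (0 : 𝕜)).smul hd.hasDerivAt).const_add (f y)
      simpa using this.deriv.symm
    · have h3 := h1.self_of_nhds
      simp only at h3
      rw [dslope_of_ne _ ht, slope_def_module]
      simp only [sub_zero, zero_smul, add_zero]
      rw [h3, smul_smul, inv_mul_cancel₀ ht, one_smul]
  · have : AnalyticAt 𝕜 (fun p : E × 𝕜 => p.2⁻¹ • (f (p.1 + p.2 • v) - f p.1)) (x, s) := by
      have h1 : AnalyticAt 𝕜 (fun p : E × 𝕜 => p.1 + p.2 • v) (x, s) :=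
        analyticAt_fst.add (analyticAt_snd.smul analyticAt_const)
      exact (analyticAt_snd.inv hs).smul
        (((hf _ (mem_univ _)).comp h1).sub ((hf _ (mem_univ _)).comp analyticAt_fst))
    refine this.congr ?_
    have : ∀ᶠ p : E × 𝕜 in 𝓝 (x, s), p.2 ≠ 0 := continuousAt_snd.eventually_ne hs
    filter_upwards [this] with p hp
    rw [dslope_of_ne _ hp, slope_def_module]
    simp

end Hadamard

/-! ### Entire majorants -/

/-- There are entire functions, real and monotone on `[0, ∞)`, of arbitrarily fast growth. -/
theorem exists_entire_majorant (C : ℕ → ℝ) :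
    ∃ (E : ℂ → ℂ) (e : ℝ → ℝ), Differentiable ℂ E ∧ (∀ r : ℝ, E r = (e r : ℂ)) ∧
      MonotoneOn e (Ici 0) ∧ ∀ r : ℝ, 1 ≤ r → C ⌊r⌋₊ ≤ e r := by
  -- The exponents make the `k`-th term of `∑ |C (k+1)| (z/(k+1)) ^ m k` at most `2⁻ᵏ` once `|z| ≤
  -- (k+1)/2`, so the series is entire.
  have hm : ∀ k : ℕ, ∃ m : ℕ, |C (k + 1)| * (1 / 2 : ℝ) ^ m ≤ (1 / 2) ^ k := by
    intro k
    have h : Tendsto (fun m : ℕ => |C (k + 1)| * (1 / 2 : ℝ) ^ m) atTop (𝓝 (|C (k + 1)| * 0)) :=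
      (tendsto_pow_atTop_nhds_zero_of_lt_one (by norm_num) (by norm_num)).const_mul _
    rw [mul_zero] at h
    exact (h.eventually (ge_mem_nhds (by positivity : (0 : ℝ) < (1 / 2) ^ k))).exists
  choose m hm using hm
  have hsum : ∀ R : ℝ, 0 ≤ R → Summable fun k : ℕ => |C (k + 1)| * (R / (k + 1)) ^ m k := by
    intro R hR
    refine Summable.of_norm_bounded_eventually_nat (g := fun k => (1 / 2 : ℝ) ^ k)
      (summable_geometric_of_lt_one (by norm_num) (by norm_num)) ?_
    filter_upwards [eventually_ge_atTop ⌈2 * R⌉₊] with k hk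
    have hk' : 2 * R ≤ k := (Nat.le_ceil _).trans (by exact_mod_cast hk)
    rw [Real.norm_of_nonneg (by positivity)]
    refine le_trans ?_ (hm k)
    have h : R / (k + 1) ≤ 1 / 2 := by
      rw [div_le_div_iff₀ (by positivity) (by norm_num)]
      linarith
    exact mul_le_mul_of_nonneg_left (pow_le_pow_left₀ (by positivity) h _) (abs_nonneg _)
  refine ⟨fun z => ∑' k : ℕ, ((|C (k + 1)| : ℝ) : ℂ) * (z / (k + 1)) ^ m k,
    fun r => ∑' k : ℕ, |C (k + 1)| * (r / (k + 1)) ^ m k, ?_, ?_, ?_, ?_⟩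
  · intro z
    have hd : DifferentiableOn ℂ (fun z : ℂ => ∑' k : ℕ, ((|C (k + 1)| : ℝ) : ℂ) * (z / (k + 1)) ^ m k)
        (Metric.ball 0 (‖z‖ + 1)) := by
      refine Complex.differentiableOn_tsum_of_summable_norm (hsum (‖z‖ + 1) (by positivity))
        (fun k => ?_) Metric.isOpen_ball fun k w hw => ?_
      · fun_prop
      · have hw' : ‖w‖ ≤ ‖z‖ + 1 := by simpa using (mem_ball_zero_iff.1 hw).le
        have hk : ‖(k : ℂ) + 1‖ = k + 1 := by
          exact_mod_cast Complex.norm_natCast (k + 1)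
        rw [norm_mul, norm_pow, norm_div, hk, Complex.norm_real, Real.norm_eq_abs, abs_abs]
        gcongr
    exact (hd z (by simp)).differentiableAt (Metric.isOpen_ball.mem_nhds (by simp))
  · intro r
    push_cast [Complex.ofReal_tsum]
    rfl
  · intro r hr s hs hrs
    have hr' : (0 : ℝ) ≤ r := hr
    exact (hsum r hr').tsum_le_tsum (fun k => by gcongr) (hsum s hs)
  · intro r hr
    have h1 : 1 ≤ ⌊r⌋₊ := Nat.one_le_floor_iff r |>.2 hr
    -- The single term with `k + 1 = ⌊r⌋₊` suffices, as its base `r / (k + 1)` is at least one.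
    obtain ⟨k, hk⟩ : ∃ k, ⌊r⌋₊ = k + 1 := ⟨_, (Nat.sub_add_cancel h1).symm⟩
    have hkr : (k : ℝ) + 1 ≤ r := by
      have := Nat.floor_le (zero_le_one.trans hr)
      rw [hk] at this; exact_mod_cast this
    have hr0 : 0 ≤ r := zero_le_one.trans hr
    calc C ⌊r⌋₊ ≤ |C (k + 1)| * 1 := by rw [hk, mul_one]; exact le_abs_self _
      _ ≤ |C (k + 1)| * (r / (k + 1)) ^ m k := by
        gcongr
        exact one_le_pow₀ (by rw [le_div_iff₀ (by positivity)]; linarith)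
      _ ≤ _ := (hsum r hr0).le_tsum k fun j _ => by positivity

/-- A continuous function on `ℝⁿ` is dominated by an entire function of `1 + ∑ xᵢ²`. -/
theorem exists_entire_majorant_of_continuous {n : ℕ} {g : PerturbDenominators.RSpace n → ℝ} (hg : Continuous g) :
    ∃ (E : ℂ → ℂ) (e : ℝ → ℝ), Differentiable ℂ E ∧ (∀ r : ℝ, E r = (e r : ℂ)) ∧
      MonotoneOn e (Ici 0) ∧ ∀ x, g x ≤ e (1 + ∑ i, x i ^ 2) := by
  have hC : ∀ k : ℕ, ∃ C : ℝ, ∀ x ∈ Metric.closedBall (0 : RSpace n) (k + 1), ‖g x‖ ≤ C :=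
    fun k => (isCompact_closedBall _ _).exists_bound_of_continuousOn hg.continuousOn
  choose C hC using hC
  obtain ⟨E, e, hE, hEe, hmono, he⟩ := exists_entire_majorant C
  refine ⟨E, e, hE, hEe, hmono, fun x => ?_⟩
  have h0 : 0 ≤ ∑ i, x i ^ 2 := Finset.sum_nonneg fun i _ => sq_nonneg _
  refine le_trans ?_ (he _ (by linarith))
  refine (le_abs_self _).trans (hC _ x ?_)
  rw [mem_closedBall_zero_iff, pi_norm_le_iff_of_nonneg (by positivity)]
  intro i
  have h1 : x i ^ 2 ≤ ∑ i, x i ^ 2 :=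
    Finset.single_le_sum (f := fun i => x i ^ 2) (fun i _ => sq_nonneg _) (Finset.mem_univ i)
  have h2 := Nat.lt_floor_add_one (1 + ∑ i, x i ^ 2)
  rw [Real.norm_eq_abs]
  refine abs_le_of_sq_le_sq ?_ (by positivity)
  nlinarith [h1, h2, h0]

/-! ### Holomorphic extensions near real points -/

namespace PerturbDenominators

variable {n : ℕ}

/-- The inclusion `ℝⁿ ⊂ ℂⁿ` as a continuous `ℝ`-linear map. -/
noncomputable def toCL (n : ℕ) : RSpace n →L[ℝ] CSpace n :=
  ContinuousLinearMap.pi fun i => Complex.ofRealCLM.comp (ContinuousLinearMap.proj i)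

/-- The coordinatewise real part as a continuous `ℝ`-linear map. -/
noncomputable def reCL (n : ℕ) : CSpace n →L[ℝ] RSpace n :=
  ContinuousLinearMap.pi fun i => Complex.reCLM.comp (ContinuousLinearMap.proj i)

theorem toCL_apply (x : RSpace n) : toCL n x = toC x := rfl

theorem reCL_toC (x : RSpace n) : reCL n (toC x) = x := rfl

theorem toC_add (x y : RSpace n) : toC (x + y) = toC x + toC y := (toCL n).map_add x y

theorem toC_smul (s : ℝ) (x : RSpace n) : toC (s • x) = (s : ℂ) • toC x := by
  ext i; simp [toC]

theorem continuous_toC : Continuous (toC : RSpace n → CSpace n) := (toCL n).continuous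

theorem norm_reCL_sub_toC_le (z : CSpace n) (a : RSpace n) : ‖reCL n z - a‖ ≤ ‖z - toC a‖ := by
  rw [pi_norm_le_iff_of_nonneg (norm_nonneg _)]
  intro i
  calc ‖(reCL n z - a) i‖ = |((z - toC a) i).re| := by
        simp [reCL, toC]
    _ ≤ ‖(z - toC a) i‖ := Complex.abs_re_le_norm _
    _ ≤ _ := norm_le_pi_norm _ i

theorem norm_toC_sub_toC (x a : RSpace n) : ‖toC x - toC a‖ = ‖x - a‖ := by
  have h : ∀ i, ‖(toC x - toC a) i‖ = ‖(x - a) i‖ := fun i => by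
    simp only [toC, Pi.sub_apply, ← Complex.ofReal_sub, Complex.norm_real]
  refine le_antisymm ?_ ?_ <;> rw [pi_norm_le_iff_of_nonneg (norm_nonneg _)] <;> intro i
  · rw [h]; exact norm_le_pi_norm _ i
  · rw [← h]; exact norm_le_pi_norm _ i

theorem toC_mem_ball_iff {x a : RSpace n} {r : ℝ} :
    toC x ∈ Metric.ball (toC a) r ↔ x ∈ Metric.ball a r := by
  rw [mem_ball_iff_norm, mem_ball_iff_norm, norm_toC_sub_toC]

theorem reCL_mem_ball {z : CSpace n} {a : RSpace n} {r : ℝ} (hz : z ∈ Metric.ball (toC a) r) :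
    reCL n z ∈ Metric.ball a r := by
  rw [mem_ball_iff_norm] at hz ⊢
  exact (norm_reCL_sub_toC_le z a).trans_lt hz

/-- Holomorphic functions on a convex open set that agree at its real points agree at every point
whose real part lies in the set. -/
theorem eq_of_eq_on_real {D : Set (CSpace n)} (hDo : IsOpen D) (hDc : Convex ℝ D)
    {G₁ G₂ : CSpace n → ℂ} (h₁ : AnalyticOnNhd ℂ G₁ D) (h₂ : AnalyticOnNhd ℂ G₂ D)
    (h : ∀ x, toC x ∈ D → G₁ (toC x) = G₂ (toC x)) {z : CSpace n} (hz : z ∈ D)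
    (hre : toC (reCL n z) ∈ D) : G₁ z = G₂ z := by
  -- The complex line `s ↦ Re z + s Im z` is real for real `s` and reaches `z` at `s = i`; its trace
  -- on `D` is convex, so the one-variable identity theorem applies.
  set x := reCL n z with hx
  set y : RSpace n := fun i => (z i).im with hy
  let L : ℂ → CSpace n := fun s => toC x + s • toC y
  have hLc : Continuous L := by fun_prop
  have hLa : ∀ s, AnalyticAt ℂ L s := fun s =>
    analyticAt_const.add (analyticAt_id.smul analyticAt_const)
  have hU : IsOpen (L ⁻¹' D) := hDo.preimage hLc
  have hUc : Convex ℝ (L ⁻¹' D) := by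
    intro s hs t ht a b ha hb hab
    have : L (a • s + b • t) = a • L s + b • L t := by
      have hab' : (a : ℂ) + b = 1 := by exact_mod_cast hab
      ext i
      simp only [L, Pi.add_apply, Pi.smul_apply, smul_eq_mul, Complex.real_smul]
      linear_combination -(toC x i) * hab'
    simpa only [mem_preimage, this] using hDc hs ht ha hb hab
  have hI : L Complex.I = z := by
    ext i
    simp only [L, Pi.add_apply, Pi.smul_apply, smul_eq_mul, toC, hx, hy]
    rw [mul_comm]
    exact Complex.re_add_im (z i)
  have hreal : ∀ s : ℝ, L s = toC (x + s • y) := fun s => by rw [toC_add, toC_smul]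
  have h0 : (0 : ℂ) ∈ L ⁻¹' D := by simpa [L] using hre
  have hfreq : ∃ᶠ s in 𝓝[≠] (0 : ℂ), G₁ (L s) = G₂ (L s) := by
    have ht : Tendsto (fun s : ℝ => (s : ℂ)) (𝓝[≠] 0) (𝓝[≠] 0) := by
      refine tendsto_nhdsWithin_iff.2 ⟨?_, ?_⟩
      · exact (Complex.continuous_ofReal.tendsto' 0 0 (by simp)).mono_left nhdsWithin_le_nhds
      · filter_upwards [self_mem_nhdsWithin] with s hs
        simpa using hs
    refine ht.frequently (Eventually.frequently ?_)
    have := (ht.mono_right nhdsWithin_le_nhds).eventually (hU.mem_nhds h0)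
    filter_upwards [this] with s hs
    have hs' : L s ∈ D := hs
    rw [hreal] at hs' ⊢
    exact h _ hs'
  have := AnalyticOnNhd.eqOn_of_preconnected_of_frequently_eq
    (f := fun s => G₁ (L s)) (g := fun s => G₂ (L s)) (U := L ⁻¹' D)
    (fun s hs => (h₁ _ hs).comp (hLa s)) (fun s hs => (h₂ _ hs).comp (hLa s))
    hUc.isPreconnected h0 hfreq (show Complex.I ∈ L ⁻¹' D by rw [mem_preimage, hI]; exact hz)
  simpa only [hI] using this

/-- Uniqueness of the holomorphic extension of a germ at a real point. -/
theorem eventuallyEq_of_eventuallyEq_real {G₁ G₂ : CSpace n → ℂ} {a : RSpace n}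
    (h₁ : AnalyticAt ℂ G₁ (toC a)) (h₂ : AnalyticAt ℂ G₂ (toC a))
    (h : ∀ᶠ x in 𝓝 a, G₁ (toC x) = G₂ (toC x)) : G₁ =ᶠ[𝓝 (toC a)] G₂ := by
  obtain ⟨r, hr, hr'⟩ := Metric.eventually_nhds_iff_ball.1
    (h₁.eventually_analyticAt.and h₂.eventually_analyticAt)
  obtain ⟨s, hs, hs'⟩ := Metric.eventually_nhds_iff_ball.1 h
  have hb : Metric.ball (toC a) (min r s) ⊆ Metric.ball (toC a) r :=
    Metric.ball_subset_ball (min_le_left _ _)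
  filter_upwards [Metric.ball_mem_nhds _ (lt_min hr hs)] with z hz
  refine eq_of_eq_on_real Metric.isOpen_ball (convex_ball _ _)
    (fun w hw => (hr' w (hb hw)).1) (fun w hw => (hr' w (hb hw)).2) (fun x hx => ?_) hz
    (toC_mem_ball_iff.2 (reCL_mem_ball hz))
  exact hs' x (Metric.ball_subset_ball (min_le_right _ _) (toC_mem_ball_iff.1 hx))

/-- Local holomorphic extensions of a real function glue to an extension on a neighbourhood of
`ℝⁿ`. -/
theorem exists_isHolomorphicExtension {h : RSpace n → ℝ}
    (hh : ∀ a, ∃ G : CSpace n → ℂ, AnalyticAt ℂ G (toC a) ∧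
      ∀ᶠ x in 𝓝 a, G (toC x) = (h x : ℂ)) :
    ∃ (U : Set (CSpace n)) (G : CSpace n → ℂ), IsHolomorphicExtension h U G := by
  choose G hGa hGe using hh
  have hr : ∀ a, ∃ r > 0, (∀ z ∈ Metric.ball (toC a) r, AnalyticAt ℂ (G a) z) ∧
      ∀ x ∈ Metric.ball a r, G a (toC x) = (h x : ℂ) := by
    intro a
    obtain ⟨r, hr, hr'⟩ := Metric.eventually_nhds_iff_ball.1 (hGa a).eventually_analyticAt
    obtain ⟨s, hs, hs'⟩ := Metric.eventually_nhds_iff_ball.1 (hGe a)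
    exact ⟨min r s, lt_min hr hs,
      fun z hz => hr' z (Metric.ball_subset_ball (min_le_left _ _) hz),
      fun x hx => hs' x (Metric.ball_subset_ball (min_le_right _ _) hx)⟩
  choose r hr0 hrA hrE using hr
  let U : Set (CSpace n) := ⋃ a, Metric.ball (toC a) (r a)
  have hU : ∀ z ∈ U, ∃ a, z ∈ Metric.ball (toC a) (r a) := fun z hz => mem_iUnion.1 hz
  classical
  let H : CSpace n → ℂ := fun z => if hz : z ∈ U then G (hU z hz).choose z else 0
  have hH : ∀ a, ∀ z ∈ Metric.ball (toC a) (r a), H z = G a z := by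
    intro a z hz
    have hzU : z ∈ U := mem_iUnion.2 ⟨a, hz⟩
    simp only [H, dif_pos hzU]
    set c := (hU z hzU).choose
    have hc : z ∈ Metric.ball (toC c) (r c) := (hU z hzU).choose_spec
    -- Intersections of balls with real centres are convex and contain the real parts of their
    -- points, so the choice of ball is immaterial.
    refine eq_of_eq_on_real (D := Metric.ball (toC c) (r c) ∩ Metric.ball (toC a) (r a))
      (Metric.isOpen_ball.inter Metric.isOpen_ball) ((convex_ball _ _).inter (convex_ball _ _))
      (fun w hw => hrA c w hw.1) (fun w hw => hrA a w hw.2) (fun x hx => ?_) ⟨hc, hz⟩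
      ⟨toC_mem_ball_iff.2 (reCL_mem_ball hc), toC_mem_ball_iff.2 (reCL_mem_ball hz)⟩
    rw [hrE c x (toC_mem_ball_iff.1 hx.1), hrE a x (toC_mem_ball_iff.1 hx.2)]
  refine ⟨U, H, ⟨isOpen_iUnion fun a => Metric.isOpen_ball, ?_⟩, ?_, fun x => ?_⟩
  · rintro _ ⟨a, rfl⟩
    exact mem_iUnion.2 ⟨a, Metric.mem_ball_self (hr0 a)⟩
  · intro z hz
    obtain ⟨a, ha⟩ := hU z hz
    refine (hrA a z ha).congr ?_
    filter_upwards [Metric.isOpen_ball.mem_nhds ha] with w hw using (hH a w hw).symm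
  · rw [hH x _ (Metric.mem_ball_self (hr0 x)), hrE x x (Metric.mem_ball_self (hr0 x))]

/-- A function on `ℝⁿ` with a holomorphic extension near a point is real analytic there. -/
theorem analyticAt_of_complex {h : RSpace n → ℝ} {a : RSpace n} {G : CSpace n → ℂ}
    (hG : AnalyticAt ℂ G (toC a)) (he : ∀ᶠ x in 𝓝 a, G (toC x) = (h x : ℂ)) :
    AnalyticAt ℝ h a := by
  have h1 : AnalyticAt ℝ (fun x => Complex.reCLM (G (toCL n x))) a :=
    (Complex.reCLM.analyticAt _).comp
      ((hG.restrictScalars (𝕜 := ℝ)).comp ((toCL n).analyticAt a))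
  refine h1.congr ?_
  filter_upwards [he] with x hx
  rw [toCL_apply, hx]; simp

/-- A map `ℝⁿ → ℝⁿ` with a holomorphic extension near a point is real analytic there. -/
theorem analyticAt_of_complex_map {h : RSpace n → RSpace n} {a : RSpace n}
    {G : CSpace n → CSpace n} (hG : AnalyticAt ℂ G (toC a))
    (he : ∀ᶠ x in 𝓝 a, G (toC x) = toC (h x)) : AnalyticAt ℝ h a := by
  have h1 : AnalyticAt ℝ (fun x => reCL n (G (toCL n x))) a :=
    ((reCL n).analyticAt _).comp
      ((hG.restrictScalars (𝕜 := ℝ)).comp ((toCL n).analyticAt a))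
  refine h1.congr ?_
  filter_upwards [he] with x hx
  rw [toCL_apply, hx, reCL_toC]

/-- The derivative of a holomorphic extension in a real direction. -/
theorem fderiv_toC_eq {h : RSpace n → ℝ} {a : RSpace n} {G : CSpace n → ℂ}
    (hG : AnalyticAt ℂ G (toC a)) (he : ∀ᶠ x in 𝓝 a, G (toC x) = (h x : ℂ)) (v : RSpace n) :
    fderiv ℂ G (toC a) (toC v) = (fderiv ℝ h a v : ℂ) := by
  have h1 : HasFDerivAt (fun x => G (toCL n x))
      (((fderiv ℂ G (toC a)).restrictScalars ℝ).comp (toCL n)) a :=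
    (hG.differentiableAt.hasFDerivAt.restrictScalars ℝ).comp a (toCL n).hasFDerivAt
  have h2 : HasFDerivAt (fun x => (h x : ℂ)) (Complex.ofRealCLM.comp (fderiv ℝ h a)) a :=
    Complex.ofRealCLM.hasFDerivAt.comp a
      (analyticAt_of_complex hG he).differentiableAt.hasFDerivAt
  have h3 := h1.unique (h2.congr_of_eventuallyEq he)
  exact DFunLike.congr_fun h3 v

end PerturbDenominators

/-! ### Shears and their complexified inverses -/

section Shear

variable {𝕜 E : Type*} [NontriviallyNormedField 𝕜] [NormedAddCommGroup E] [NormedSpace 𝕜 E]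

/-- The linear map `w ↦ w + (d w - l w) • v` is invertible if `l v = 1` and `d v ≠ 0`. -/
theorem ContinuousLinearMap.exists_shear_equiv (l d : E →L[𝕜] 𝕜) (v : E) (hl : l v = 1)
    (hd : d v ≠ 0) :
    ∃ e : E ≃L[𝕜] E, (e : E →L[𝕜] E) = ContinuousLinearMap.id 𝕜 E + (d - l).smulRight v := by
  refine ⟨ContinuousLinearEquiv.equivOfInverse
    (ContinuousLinearMap.id 𝕜 E + (d - l).smulRight v)
    (ContinuousLinearMap.id 𝕜 E - ((d v)⁻¹ • (d - l)).smulRight v) (fun w => ?_) (fun w => ?_), ?_⟩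
  · have : (d v)⁻¹ * ((d w - l w) * d v) = d w - l w := by field_simp
    simp [hl, this]
  · have : (d v)⁻¹ * (d w - l w) * d v = d w - l w := by field_simp
    simp [hl, this]
  · ext w; rfl

theorem AnalyticAt.shear {S : E → 𝕜} {a : E} (hS : AnalyticAt 𝕜 S a) (l : E →L[𝕜] 𝕜) (v : E) :
    AnalyticAt 𝕜 (fun x => x + (S x - l x) • v) a :=
  analyticAt_id.add ((hS.sub (l.analyticAt a)).smul analyticAt_const)

theorem AnalyticAt.exists_hasStrictFDerivAt_shear [CompleteSpace 𝕜] {S : E → 𝕜} {a : E}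
    (hS : AnalyticAt 𝕜 S a) {l : E →L[𝕜] 𝕜} {v : E} (hl : l v = 1) (hd : fderiv 𝕜 S a v ≠ 0) :
    ∃ e : E ≃L[𝕜] E,
      HasStrictFDerivAt (fun x => x + (S x - l x) • v) (e : E →L[𝕜] E) a := by
  obtain ⟨e, he⟩ := l.exists_shear_equiv (fderiv 𝕜 S a) v hl hd
  refine ⟨e, he ▸ ?_⟩
  exact (hasStrictFDerivAt_id a).add
    ((hS.hasStrictFDerivAt.sub l.hasStrictFDerivAt).smul_const v)

end Shear

namespace PerturbDenominators

variable {n : ℕ}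

/-- The inverse of a shear bijection `x ↦ x + (S x - l x) • v` of `ℝⁿ` extends holomorphically
near real points. -/
theorem exists_complex_germ_symm {S : RSpace n → ℝ} {SC : CSpace n → ℂ} {a : RSpace n}
    (hSC : AnalyticAt ℂ SC (toC a)) (hS : ∀ x, SC (toC x) = (S x : ℂ))
    {l : RSpace n →L[ℝ] ℝ} {lC : CSpace n →L[ℂ] ℂ} (hlC : ∀ x, lC (toC x) = (l x : ℂ))
    {v : RSpace n} (hl : l v = 1) (hd : fderiv ℝ S a v ≠ 0) (e : RSpace n ≃ RSpace n)
    (he : ∀ x, e x = x + (S x - l x) • v) :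
    ∃ Ψ : CSpace n → CSpace n, AnalyticAt ℂ Ψ (toC (e a)) ∧
      ∀ᶠ y in 𝓝 (e a), Ψ (toC y) = toC (e.symm y) := by
  have hSe : ∀ᶠ x in 𝓝 a, SC (toC x) = (S x : ℂ) := Eventually.of_forall hS
  have hSa : AnalyticAt ℝ S a := analyticAt_of_complex hSC hSe
  have hdC : fderiv ℂ SC (toC a) (toC v) ≠ 0 := by
    rw [fderiv_toC_eq hSC hSe]; exact_mod_cast hd
  obtain ⟨A, hA⟩ := hSa.exists_hasStrictFDerivAt_shear hl hd
  obtain ⟨A', hA'⟩ := hSC.exists_hasStrictFDerivAt_shear (by rw [hlC, hl]; simp) hdC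
  -- Every point near `e a` is the image of a point near `a`, so the complex local inverse need only
  -- be compared with `e.symm` on such images.
  have hmap : map e (𝓝 a) = 𝓝 (e a) := by
    have := hA.map_nhds_eq_of_equiv
    rwa [show (fun x => x + (S x - l x) • v) = e from (funext he).symm, ← he] at this
  have hC : ∀ x, toC x + (SC (toC x) - lC (toC x)) • toC v = toC (e x) := fun x => by
    rw [he, toC_add, toC_smul, hS, hlC]; push_cast; rfl
  let T := hA'.toOpenPartialHomeomorph _
  have hT : ∀ z, T z = z + (SC z - lC z) • toC v := fun z => rfl
  have ha : toC a ∈ T.source := hA'.mem_toOpenPartialHomeomorph_source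
  have hTa : T (toC a) = toC (e a) := by rw [hT, hC]
  refine ⟨T.symm, ?_, ?_⟩
  · rw [← hTa]
    exact T.analyticAt_symm' ha (hSC.shear lC (toC v)) hA'.hasFDerivAt.fderiv
  · rw [← hmap, eventually_map]
    filter_upwards [continuous_toC.continuousAt.eventually (T.open_source.mem_nhds ha)] with x hx
    rw [← hC, ← hT, T.left_inv hx, e.symm_apply_apply]

/-- Transition maps between two shear bijections extend holomorphically near real points. -/
theorem exists_complex_germ_transition {S₁ S₂ : RSpace n → ℝ} {S₁C S₂C : CSpace n → ℂ}
    (h₁C : ∀ a, AnalyticAt ℂ S₁C (toC a)) (h₁ : ∀ x, S₁C (toC x) = (S₁ x : ℂ))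
    (h₂C : ∀ a, AnalyticAt ℂ S₂C (toC a)) (h₂ : ∀ x, S₂C (toC x) = (S₂ x : ℂ))
    {l : RSpace n →L[ℝ] ℝ} {lC : CSpace n →L[ℂ] ℂ} (hlC : ∀ x, lC (toC x) = (l x : ℂ))
    {v : RSpace n} (hl : l v = 1) (hd : ∀ a, fderiv ℝ S₂ a v ≠ 0) (e₁ e₂ : RSpace n ≃ RSpace n)
    (he₁ : ∀ x, e₁ x = x + (S₁ x - l x) • v) (he₂ : ∀ x, e₂ x = x + (S₂ x - l x) • v)
    (a : RSpace n) :
    ∃ Ψ : CSpace n → CSpace n, AnalyticAt ℂ Ψ (toC a) ∧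
      ∀ᶠ x in 𝓝 a, Ψ (toC x) = toC (e₂.symm (e₁ x)) := by
  obtain ⟨Ψ, hΨ, hΨe⟩ :=
    exists_complex_germ_symm (h₂C (e₂.symm (e₁ a))) h₂ hlC hl (hd _) e₂ he₂
  rw [e₂.apply_symm_apply] at hΨ hΨe
  have hC : ∀ x, toC x + (S₁C (toC x) - lC (toC x)) • toC v = toC (e₁ x) := fun x => by
    rw [he₁, toC_add, toC_smul, h₁, hlC]; push_cast; rfl
  refine ⟨fun z => Ψ (z + (S₁C z - lC z) • toC v), ?_, ?_⟩
  · refine AnalyticAt.comp (g := Ψ) ?_ ((h₁C a).shear lC (toC v))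
    rwa [hC]
  · have hc : ContinuousAt e₁ a := by
      rw [show (e₁ : RSpace n → RSpace n) = _ from funext he₁]
      exact ((analyticAt_of_complex (h₁C a) (Eventually.of_forall h₁)).shear l v).continuousAt
    filter_upwards [hc.eventually hΨe] with x hx
    rw [hC, hx]

end PerturbDenominators

namespace PerturbDenominators

/-! ### Growth along parallel lines -/

section Lines

variable {E : Type*} [NormedAddCommGroup E] [NormedSpace ℝ E]

theorem hasDerivAt_line {W : E → ℝ} (hW : Differentiable ℝ W) (x v : E) (s : ℝ) :
    HasDerivAt (fun s : ℝ => W (x + s • v)) (fderiv ℝ W (x + s • v) v) s := by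
  have h1 : HasDerivAt (fun s : ℝ => x + s • v) v s := by
    simpa using ((hasDerivAt_id s).smul_const v).const_add x
  exact (hW _).hasFDerivAt.comp_hasDerivAt s h1

/-- A function with directional derivative at least one grows at least linearly along lines. -/
theorem le_sub_of_one_le_fderiv {W : E → ℝ} (hW : Differentiable ℝ W) {v : E}
    (h : ∀ x, 1 ≤ fderiv ℝ W x v) (x : E) {s : ℝ} (hs : 0 ≤ s) :
    s ≤ W (x + s • v) - W x := by
  have hd : ∀ s : ℝ, HasDerivAt (fun s : ℝ => W (x + s • v) - s)
      (fderiv ℝ W (x + s • v) v - 1) s := fun s =>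
    (hasDerivAt_line hW x v s).sub (hasDerivAt_id s)
  have hm : Monotone (fun s : ℝ => W (x + s • v) - s) :=
    monotone_of_deriv_nonneg (fun s => (hd s).differentiableAt) fun s => by
      rw [(hd s).deriv]; linarith [h (x + s • v)]
  have := hm hs
  simp only [zero_smul, add_zero] at this
  linarith

/-- The map preserves each line parallel to `v`, and `l` of the image is `W x`. On such a line `W`
is strictly increasing and unbounded in both directions. -/
theorem bijective_shear {W : E → ℝ} (hW : Differentiable ℝ W) {v : E}
    (h : ∀ x, 1 ≤ fderiv ℝ W x v) {l : E →L[ℝ] ℝ} (hl : l v = 1) :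
    Function.Bijective (fun x => x + (W x - l x) • v) := by
  have hm := fun x s hs => le_sub_of_one_le_fderiv hW h x (s := s) hs
  constructor
  · intro x y hxy
    simp only at hxy
    have hy : y = x + ((W x - l x) - (W y - l y)) • v := by
      rw [sub_smul, ← add_sub_assoc, hxy]; abel
    have hWxy : W x = W y := by
      have := congrArg l hxy
      simpa [hl] using this
    set s := (W x - l x) - (W y - l y)
    have hs : s = 0 := by
      rcases le_total 0 s with h0 | h0
      · have := hm x s h0
        rw [← hy] at this; linarith
      · have := hm y (-s) (by linarith)
        have hx : y + (-s) • v = x := by rw [hy]; simp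
        rw [hx] at this; linarith
    rw [hy, hs]; simp
  · intro y
    have hc : Continuous fun s : ℝ => W (y + s • v) := hW.continuous.comp (by fun_prop)
    set M := |l y - W y|
    have hM : 0 ≤ M := abs_nonneg _
    have h1 : W (y + (-M) • v) ≤ l y := by
      have := hm (y + (-M) • v) M hM
      rw [show y + (-M) • v + M • v = y by simp] at this
      linarith [neg_abs_le (l y - W y)]
    have h2 : l y ≤ W (y + M • v) := by
      have := hm y M hM
      linarith [le_abs_self (l y - W y)]
    obtain ⟨s, -, hs⟩ := intermediate_value_Icc (by linarith : -M ≤ M) hc.continuousOn ⟨h1, h2⟩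
    refine ⟨y + s • v, ?_⟩
    simp only at hs ⊢
    rw [hs]
    simp [hl]

theorem one_add_two_mul_abs_dslope_le {S f : E → ℝ} (hS : Differentiable ℝ S)
    (hf : Differentiable ℝ f) {v : E} (h : ∀ x, 1 + 2 * |fderiv ℝ f x v| ≤ fderiv ℝ S x v)
    (x : E) (s : ℝ) :
    1 + 2 * |dslope (fun s : ℝ => f (x + s • v)) 0 s| ≤ dslope (fun s : ℝ => S (x + s • v)) 0 s := by
  -- Linear growth of `S - c f` along `v`; the cases `c = ±2` together bound the absolute value.
  have key : ∀ c : ℝ, |c| ≤ 2 → 1 + c * dslope (fun s : ℝ => f (x + s • v)) 0 s ≤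
      dslope (fun s : ℝ => S (x + s • v)) 0 s := by
    intro c hc
    have hW : Differentiable ℝ (fun y => S y - c * f y) := hS.sub (hf.const_mul c)
    have hW1 : ∀ y, 1 ≤ fderiv ℝ (fun y => S y - c * f y) y v := by
      intro y
      rw [((hS y).hasFDerivAt.fun_sub ((hf y).hasFDerivAt.const_mul c)).fderiv]
      have h1 : c * fderiv ℝ f y v ≤ 2 * |fderiv ℝ f y v| := by
        refine (le_abs_self _).trans ?_
        rw [abs_mul]; gcongr
      have := h y
      simp only [FunLike.coe_sub, FunLike.coe_smul, Pi.sub_apply, Pi.smul_apply, smul_eq_mul]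
      linarith
    have hm := fun x s hs => le_sub_of_one_le_fderiv hW hW1 x (s := s) hs
    rcases eq_or_ne s 0 with rfl | hs
    · rw [dslope_same, dslope_same, (hasDerivAt_line hf x v 0).deriv,
        (hasDerivAt_line hS x v 0).deriv]
      have h1 : c * fderiv ℝ f x v ≤ 2 * |fderiv ℝ f x v| := by
        refine (le_abs_self _).trans ?_
        rw [abs_mul]; gcongr
      have := h x
      simp only [zero_smul, add_zero]
      linarith
    · rw [dslope_of_ne _ hs, dslope_of_ne _ hs, slope_def_field, slope_def_field]
      simp only [zero_smul, add_zero, sub_zero]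
      rw [← mul_div_assoc, ← sub_nonneg]
      rcases lt_or_gt_of_ne hs with h0 | h0
      · have := hm (x + s • v) (-s) (by linarith)
        rw [show x + s • v + (-s) • v = x by simp] at this
        rw [show ∀ a b : ℝ, a / s - (1 + b / s) = (s + b - a) / (-s) from fun a b => by
          field_simp; ring]
        exact div_nonneg (by linarith) (by linarith)
      · have := hm x s h0.le
        rw [show ∀ a b : ℝ, a / s - (1 + b / s) = (a - b - s) / s from fun a b => by
          field_simp; ring]
        exact div_nonneg (by linarith) h0.le
  rcases abs_cases (dslope (fun s : ℝ => f (x + s • v)) 0 s) with ⟨h1, -⟩ | ⟨h1, -⟩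
  · rw [h1]; exact key 2 (by norm_num)
  · rw [h1]; have := key (-2) (by norm_num); linarith

end Lines

/-! ### Choice of the parameter -/

/-- Functions of the form `t ↦ G (w k + t c k v)` have, for a common parameter `t`, no zeros. -/
theorem exists_param_ne_zero {n : ℕ} {G : CSpace n → ℂ} {y v : CSpace n} (hG : AnalyticAt ℂ G y)
    (hne : ∃ᶠ τ in 𝓝 (0 : ℂ), G (y + τ • v) ≠ 0) {w : ℕ → CSpace n} {c : ℕ → ℂ}
    (hw : Tendsto w atTop (𝓝 y)) (hc : Tendsto c atTop (𝓝 0)) (hc0 : ∀ k, c k ≠ 0) :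
    ∃ t ∈ Icc (0 : ℝ) 1, ∀ᶠ k in atTop, G (w k + ((t : ℂ) * c k) • v) ≠ 0 := by
  have hcont : Tendsto (fun p : CSpace n × ℂ => p.1 + p.2 • v) (𝓝 (y, 0)) (𝓝 y) :=
    Continuous.tendsto' (by fun_prop) _ _ (by simp)
  obtain ⟨ε, hε, hball⟩ := Metric.eventually_nhds_iff_ball.1
    (hcont.eventually hG.eventually_analyticAt)
  have hball' : ∀ z ∈ Metric.ball y ε, ∀ τ ∈ Metric.ball (0 : ℂ) ε, AnalyticAt ℂ G (z + τ • v) :=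
    fun z hz τ hτ => hball (z, τ) (by rw [← ball_prod_same]; exact ⟨hz, hτ⟩)
  -- One `τ₀` with `G (y + τ₀ • v) ≠ 0` also shows, for all large `k`, that `τ ↦ G (w k + τ • v)` is
  -- not identically zero.
  obtain ⟨τ₀, hτ₀, hτ₀ε⟩ := (hne.and_eventually (Metric.ball_mem_nhds _ hε)).exists
  have hev : ∀ᶠ k in atTop, w k ∈ Metric.ball y ε ∧ c k ∈ Metric.ball (0 : ℂ) ε ∧
      G (w k + τ₀ • v) ≠ 0 := by
    refine (hw.eventually (Metric.ball_mem_nhds _ hε)).and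
      ((hc.eventually (Metric.ball_mem_nhds _ hε)).and ?_)
    have h1 : Tendsto (fun k => G (w k + τ₀ • v)) atTop (𝓝 (G (y + τ₀ • v))) :=
      (hball' y (Metric.mem_ball_self hε) τ₀ hτ₀ε).continuousAt.tendsto.comp
        (hw.add tendsto_const_nhds)
    exact h1.eventually_ne hτ₀
  have hfin : ∀ k, w k ∈ Metric.ball y ε ∧ c k ∈ Metric.ball (0 : ℂ) ε ∧ G (w k + τ₀ • v) ≠ 0 →
      {t : ℝ | t ∈ Icc (0 : ℝ) 1 ∧ G (w k + ((t : ℂ) * c k) • v) = 0}.Finite := by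
    rintro k ⟨hwk, hck, hk⟩
    by_contra hinf
    obtain ⟨t₁, ht₁, hacc⟩ := Set.Infinite.exists_accPt_of_subset_isCompact hinf isCompact_Icc
      fun t ht => ht.1
    rw [accPt_iff_frequently_nhdsNE] at hacc
    have hmul : Tendsto (fun t : ℝ => (t : ℂ) * c k) (𝓝[≠] t₁) (𝓝[≠] ((t₁ : ℂ) * c k)) := by
      refine tendsto_nhdsWithin_iff.2 ⟨?_, ?_⟩
      · exact (Continuous.tendsto (by fun_prop) t₁).mono_left nhdsWithin_le_nhds
      · filter_upwards [self_mem_nhdsWithin] with t ht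
        simpa [hc0 k] using ht
    have hfr : ∃ᶠ τ in 𝓝[≠] ((t₁ : ℂ) * c k), G (w k + τ • v) = 0 :=
      hmul.frequently (hacc.mono fun t ht => ht.2)
    have ht₁b : (t₁ : ℂ) * c k ∈ Metric.ball (0 : ℂ) ε := by
      rw [mem_ball_zero_iff] at hck ⊢
      rw [norm_mul, Complex.norm_real, Real.norm_of_nonneg ht₁.1]
      exact (mul_le_of_le_one_left (norm_nonneg _) ht₁.2).trans_lt hck
    refine hk (AnalyticOnNhd.eqOn_zero_of_preconnected_of_frequently_eq_zero
      (f := fun τ : ℂ => G (w k + τ • v)) (U := Metric.ball 0 ε) (fun τ hτ => ?_)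
      (convex_ball _ _).isPreconnected ht₁b hfr hτ₀ε)
    exact (hball' _ hwk τ hτ).comp (f := fun τ : ℂ => w k + τ • v)
      (analyticAt_const.add (analyticAt_id.smul analyticAt_const))
  obtain ⟨N, hN⟩ := eventually_atTop.1 hev
  -- Otherwise `[0,1]` would be a countable union of finite sets.
  by_contra! hcon
  have hsub : Icc (0 : ℝ) 1 ⊆ ⋃ k ∈ Ici N,
      {t : ℝ | t ∈ Icc (0 : ℝ) 1 ∧ G (w k + ((t : ℂ) * c k) • v) = 0} := by
    intro t ht
    obtain ⟨k, hk, hk0⟩ := frequently_atTop.1 (hcon t ht) N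
    exact mem_iUnion₂.2 ⟨k, hk, ht, by simpa using hk0⟩
  have hcount := (Set.Countable.biUnion (to_countable (Ici N))
    fun k hk => (hfin k (hN k hk)).countable).mono hsub
  exact (Cardinal.mk_Icc_real (zero_lt_one)).not_lt
    (lt_of_le_of_lt (Cardinal.le_aleph0_iff_set_countable.2 hcount) Cardinal.aleph0_lt_continuum)

end PerturbDenominators

namespace PerturbDenominators

variable {n : ℕ}

/-! ### The dominating function `S` -/

/-- For every direction `v ≠ 0` and every continuous `g` there is an analytic function on `ℝⁿ`,
with an entire extension, whose derivative along `v` dominates `g`. -/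
theorem exists_entire_le_fderiv {g : RSpace n → ℝ} (hg : Continuous g) {v : RSpace n}
    (hv : v ≠ 0) :
    ∃ (l : RSpace n →L[ℝ] ℝ) (lC : CSpace n →L[ℂ] ℂ) (S : RSpace n → ℝ) (SC : CSpace n → ℂ),
      l v = 1 ∧ (∀ x, lC (toC x) = (l x : ℂ)) ∧ (∀ z, AnalyticAt ℂ SC z) ∧
      (∀ x, SC (toC x) = (S x : ℂ)) ∧ ∀ x, g x ≤ fderiv ℝ S x v := by
  obtain ⟨E, e, hE, hEe, hmono, hge⟩ := exists_entire_majorant_of_continuous hg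
  set q : ℝ := ∑ i, v i ^ 2 with hq
  have hq0 : 0 < q := by
    obtain ⟨i, hi⟩ := Function.ne_iff.1 hv
    exact Finset.sum_pos' (fun i _ => sq_nonneg _)
      ⟨i, Finset.mem_univ i, sq_pos_of_ne_zero hi⟩
  -- With `l = ⟨·, v⟩ / |v|²`, the function `S = l e(1 + |x|²)` has `∂ᵥS = e + 2 |v|² l² e'`, whose
  -- last term is nonnegative because `e` is monotone.
  let l : RSpace n →L[ℝ] ℝ := ∑ i, (v i / q) • ContinuousLinearMap.proj i
  let lC : CSpace n →L[ℂ] ℂ := ∑ i, ((v i / q : ℝ) : ℂ) • ContinuousLinearMap.proj i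
  have hl : ∀ x, l x = ∑ i, v i / q * x i := fun x => by simp [l]
  have hlC : ∀ z, lC z = ∑ i, ((v i / q : ℝ) : ℂ) * z i := fun z => by simp [lC]
  have hlv : l v = 1 := by
    rw [hl]
    have : ∀ i, v i / q * v i = v i ^ 2 / q := fun i => by ring
    simp only [this]
    rw [← Finset.sum_div, ← hq, div_self hq0.ne']
  have hlx : ∀ x, ∑ i, x i * v i = q * l x := fun x => by
    rw [hl, Finset.mul_sum]
    exact Finset.sum_congr rfl fun i _ => by field_simp
  have hlCl : ∀ x, lC (toC x) = (l x : ℂ) := fun x => by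
    rw [hl, hlC]; push_cast; rfl
  let S : RSpace n → ℝ := fun x => l x * e (1 + ∑ i, x i ^ 2)
  let SC : CSpace n → ℂ := fun z => lC z * E (1 + ∑ i, z i ^ 2)
  have hSC : ∀ z, AnalyticAt ℂ SC z := by
    intro z
    have hsum : AnalyticAt ℂ (fun z : CSpace n => 1 + ∑ i, z i ^ 2) z :=
      analyticAt_const.add (Finset.analyticAt_fun_sum _ fun i _ =>
        ((ContinuousLinearMap.proj (R := ℂ) (φ := fun _ : Fin n => ℂ) i).analyticAt z).pow 2)
    exact (lC.analyticAt z).mul ((hE.analyticAt _).comp hsum)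
  have hS : ∀ x, SC (toC x) = (S x : ℂ) := by
    intro x
    simp only [S, SC, hlCl, Complex.ofReal_mul, ← hEe]
    push_cast
    rfl
  refine ⟨l, lC, S, SC, hlv, hlCl, hSC, hS, fun x => ?_⟩
  have hSd : Differentiable ℝ S := fun x =>
    (analyticAt_of_complex (hSC _) (Eventually.of_forall hS)).differentiableAt
  have hline : HasDerivAt (fun s : ℝ => x + s • v) v 0 := by
    simpa using ((hasDerivAt_id (0 : ℝ)).smul_const v).const_add x
  have h1 : HasDerivAt (fun s : ℝ => S (x + s • v)) (fderiv ℝ S x v) 0 := by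
    simpa using hasDerivAt_line hSd x v 0
  have h2 : HasDerivAt (fun s : ℝ => l (x + s • v)) 1 0 := by
    rw [← hlv]; exact l.hasFDerivAt.comp_hasDerivAt (0 : ℝ) hline
  have h3 : HasDerivAt (fun s : ℝ => 1 + ∑ i, (x + s • v) i ^ 2) (2 * (q * l x)) 0 := by
    rw [← hlx, Finset.mul_sum]
    refine HasDerivAt.const_add 1 (HasDerivAt.fun_sum fun i _ => ?_)
    simpa [mul_assoc] using ((hasDerivAt_pi.1 hline i).fun_pow 2)
  set r := 1 + ∑ i, x i ^ 2 with hr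
  have hr0 : 0 < r := by
    have : 0 ≤ ∑ i, x i ^ 2 := Finset.sum_nonneg fun i _ => sq_nonneg _
    linarith
  have hed : DifferentiableAt ℝ e r := by
    have := (hE r).hasDerivAt.real_of_complex
    simp only [hEe, Complex.ofReal_re] at this
    exact this.differentiableAt
  have he' : 0 ≤ deriv e r := by
    rw [← derivWithin_of_mem_nhds (Ici_mem_nhds hr0)]
    exact hmono.derivWithin_nonneg
  have h4 : HasDerivAt (fun s : ℝ => e (1 + ∑ i, (x + s • v) i ^ 2))
      (deriv e r * (2 * (q * l x))) 0 :=
    HasDerivAt.comp (0 : ℝ) (by simpa [hr] using hed.hasDerivAt) h3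
  have h5 := h1.unique (h2.mul h4)
  rw [h5]
  simp only [zero_smul, add_zero, one_mul]
  have := hge x
  have h6 : 0 ≤ l x * (deriv e r * (2 * (q * l x))) := by
    rw [show l x * (deriv e r * (2 * (q * l x))) = 2 * q * deriv e r * (l x) ^ 2 by ring]
    positivity
  linarith

/-! ### The unit factor -/

section Shears

variable {f S : RSpace n → ℝ} {v : RSpace n} {l : RSpace n →L[ℝ] ℝ}

/-- If `φ` moves points along `v` so that `S ∘ φ = S + t f`, then `f ∘ φ` is a unit multiple
of `f`. -/
theorem exists_unit_of_shear (hf : AnalyticOnNhd ℝ f univ) (hS : AnalyticOnNhd ℝ S univ)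
    (h : ∀ x, 1 + 2 * |fderiv ℝ f x v| ≤ fderiv ℝ S x v) {t : ℝ} (ht : t ∈ Icc (0 : ℝ) 1)
    {φ : RSpace n → RSpace n} {σ : RSpace n → ℝ} (hσ : AnalyticOnNhd ℝ σ univ)
    (hφσ : ∀ x, φ x = x + σ x • v) (hSφ : ∀ x, S (φ x) = S x + t * f x) :
    ∃ u : (AnalyticRing n)ˣ, f ∘ φ = f * ((u : AnalyticRing n) : RSpace n → ℝ) := by
  set P : RSpace n → ℝ := fun x => dslope (fun s : ℝ => f (x + s • v)) 0 (σ x) with hP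
  set Q : RSpace n → ℝ := fun x => dslope (fun s : ℝ => S (x + s • v)) 0 (σ x) with hQ
  have hPQ : ∀ x, 1 + 2 * |P x| ≤ Q x := fun x =>
    one_add_two_mul_abs_dslope_le (fun x => (hS x (mem_univ x)).differentiableAt)
      (fun x => (hf x (mem_univ x)).differentiableAt) h x (σ x)
  have hQ0 : ∀ x, 0 < Q x := fun x => by linarith [hPQ x, abs_nonneg (P x)]
  have hpair : AnalyticOnNhd ℝ (fun x => (x, σ x)) univ := analyticOnNhd_id.prod hσ
  have hPa : AnalyticOnNhd ℝ P univ := (hf.dslope_line v).comp hpair fun _ _ => mem_univ _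
  have hQa : AnalyticOnNhd ℝ Q univ := (hS.dslope_line v).comp hpair fun _ _ => mem_univ _
  have hua : AnalyticOnNhd ℝ (fun x => 1 + t * P x / Q x) univ :=
    analyticOnNhd_const.add ((analyticOnNhd_const.mul hPa).div hQa fun x _ => (hQ0 x).ne')
  have hu0 : ∀ x, 1 + t * P x / Q x ≠ 0 := by
    intro x
    have h1 : |t * P x| ≤ |P x| := by
      rw [abs_mul, abs_of_nonneg ht.1]
      exact mul_le_of_le_one_left (abs_nonneg _) ht.2
    have h2 := neg_abs_le (t * P x)
    have h3 : 0 < Q x + t * P x := by linarith [hPQ x, abs_nonneg (P x)]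
    rw [show 1 + t * P x / Q x = (Q x + t * P x) / Q x by
      rw [add_div, div_self (hQ0 x).ne']]
    exact (div_pos h3 (hQ0 x)).ne'
  let u : AnalyticRing n := ⟨_, hua⟩
  let w : AnalyticRing n := ⟨_, hua.inv fun x _ => hu0 x⟩
  refine ⟨⟨u, w, Subtype.ext ?_, Subtype.ext ?_⟩, ?_⟩
  · ext x; exact mul_inv_cancel₀ (hu0 x)
  · ext x; exact inv_mul_cancel₀ (hu0 x)
  · ext x
    -- Eliminating `σ` between the two identities needs division only by `Q`, so zeros of `f` and
    -- `σ` are harmless.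
    have hPx : σ x * P x = f (φ x) - f x := by
      simpa [hP, hφσ x] using sub_smul_dslope (fun s : ℝ => f (x + s • v)) 0 (σ x)
    have hQx : σ x * Q x = t * f x := by
      have := sub_smul_dslope (fun s : ℝ => S (x + s • v)) 0 (σ x)
      simp only [sub_zero, smul_eq_mul, zero_smul, add_zero, ← hφσ x, hSφ x] at this
      rw [hQ, this]; ring
    change f (φ x) = f x * (1 + t * P x / Q x)
    have h1 := (hQ0 x).ne'
    field_simp
    linear_combination (-Q x) * hPx + P x * hQx

end Shears

end PerturbDenominators

/-! ### Construction of the diffeomorphism -/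

open PerturbDenominators

theorem mainTheorem7 (n : ℕ) (b f : AnalyticRing n)
    (hb : NonConstant (b : RSpace n → ℝ)) (hf : NonConstant (f : RSpace n → ℝ))
    (Ω : Set (CSpace n)) (hΩ : IsOpenNhdOfReal Ω) (hΩinv : IsInvariant Ω)
    (B F : CSpace n → ℂ)
    (hB : IsHolomorphicExtension (b : RSpace n → ℝ) Ω B)
    (hF : IsHolomorphicExtension (f : RSpace n → ℝ) Ω F)
    (Z : Set (CSpace n)) (hZ : IsComplexAnalyticSet Ω Z)
    (x₀ : RSpace n) (hx₀ : (f : RSpace n → ℝ) x₀ = 0)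
    (hZF : ¬ GermSubset (toC x₀) Z (zeroSet Ω F)) :
    ∃ φ : RSpace n ≃ RSpace n,
      AnalyticOnNhd ℝ φ Set.univ ∧ AnalyticOnNhd ℝ φ.symm Set.univ ∧
      (∃ u : (AnalyticRing n)ˣ,
        (f : RSpace n → ℝ) ∘ φ = (f : RSpace n → ℝ) * ((u : AnalyticRing n) : RSpace n → ℝ)) ∧
      ∃ (Ω₀ : Set (CSpace n)) (B₀ : CSpace n → ℂ), Ω₀ ⊆ Ω ∧
        IsHolomorphicExtension ((b : RSpace n → ℝ) ∘ φ) Ω₀ B₀ ∧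
        ¬ GermSubset (toC x₀) Z (zeroSet Ω₀ B₀) := by
  obtain ⟨b, hba : AnalyticOnNhd ℝ b univ⟩ := b
  obtain ⟨f, hfa : AnalyticOnNhd ℝ f univ⟩ := f
  simp only at hb hf hB hF hx₀ ⊢
  have hBa : ∀ x, AnalyticAt ℂ B (toC x) := fun x => hB.2.1 _ (hΩ.2 (mem_range_self x))
  have hFa : ∀ x, AnalyticAt ℂ F (toC x) := fun x => hF.2.1 _ (hΩ.2 (mem_range_self x))
  have hfd : Differentiable ℝ f := fun x => (hfa x (mem_univ x)).differentiableAt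
  obtain ⟨x₁, hx₁⟩ : ∃ x₁, b x₁ ≠ b x₀ := by
    by_contra! hcon
    exact hb ⟨_, hcon⟩
  set v := x₁ - x₀ with hv
  have hv0 : v ≠ 0 := fun h => hx₁ (by rw [sub_eq_zero.1 h])
  have hgc : Continuous fun x => 1 + 2 * |fderiv ℝ f x v| := by
    have : Continuous (fderiv ℝ f) :=
      continuousOn_univ.1 (hfa.fderiv).continuousOn
    fun_prop
  obtain ⟨l, lC, S, SC, hl, hlC, hSC, hSe, hSf⟩ := exists_entire_le_fderiv hgc hv0
  have hSa : AnalyticOnNhd ℝ S univ := fun x _ =>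
    analyticAt_of_complex (hSC _) (Eventually.of_forall hSe)
  have hSd : Differentiable ℝ S := fun x => (hSa x (mem_univ x)).differentiableAt
  have hS1 : ∀ x, 1 ≤ fderiv ℝ S x v := fun x => by
    linarith [hSf x, abs_nonneg (fderiv ℝ f x v)]
  let eS : RSpace n ≃ RSpace n := Equiv.ofBijective _ (bijective_shear hSd hS1 hl)
  have heS : ∀ x, eS x = x + (S x - l x) • v := fun x => rfl
  have hS0 : ∀ x, fderiv ℝ S x v ≠ 0 := fun x => (zero_lt_one.trans_le (hS1 x)).ne'
  -- a holomorphic extension of `b ∘ eS⁻¹`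
  obtain ⟨Ψ, hΨ, hΨe⟩ := exists_complex_germ_symm (hSC (toC x₀)) hSe hlC hl (hS0 x₀) eS heS
  have hΨ0 : Ψ (toC (eS x₀)) = toC x₀ := by simpa using hΨe.self_of_nhds
  have hG : AnalyticAt ℂ (fun y => B (Ψ y)) (toC (eS x₀)) :=
    AnalyticAt.comp (g := B) (by rw [hΨ0]; exact hBa x₀) hΨ
  -- The shear `eS` carries the line `x₀ + s • v` to a parallel line with parameter `τ = S (x₀ + s •
  -- v) - S x₀`, so at these real `τ` the function takes the values of `b` on the original line.
  have hne : ∃ᶠ τ in 𝓝 (0 : ℂ), B (Ψ (toC (eS x₀) + τ • toC v)) ≠ 0 := by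
    have hbl : ∃ᶠ s in 𝓝 (0 : ℝ), b (x₀ + s • v) ≠ 0 := by
      intro hcon
      simp only [not_not] at hcon
      have hbla : AnalyticOnNhd ℝ (fun s : ℝ => b (x₀ + s • v)) univ := fun s _ =>
        (hba _ (mem_univ _)).comp (f := fun s : ℝ => x₀ + s • v)
          (analyticAt_const.add (analyticAt_id.smul analyticAt_const))
      have h0 := hbla.eqOn_zero_of_preconnected_of_eventuallyEq_zero isPreconnected_univ
        (mem_univ 0) hcon
      have h1 : b (x₀ + (1 : ℝ) • v) = 0 := h0 (mem_univ 1)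
      have h2 : b (x₀ + (0 : ℝ) • v) = 0 := h0 (mem_univ 0)
      simp only [one_smul, zero_smul, add_zero, hv, add_sub_cancel] at h1 h2
      exact hx₁ (by rw [h1, h2])
    have hτ : Tendsto (fun s : ℝ => S (x₀ + s • v) - S x₀) (𝓝 0) (𝓝 0) :=
      Continuous.tendsto' (by have := hSd.continuous; fun_prop) _ _ (by simp)
    have hτC : Tendsto (fun s : ℝ => ((S (x₀ + s • v) - S x₀ : ℝ) : ℂ)) (𝓝 0) (𝓝 0) :=
      (Complex.continuous_ofReal.tendsto' 0 0 (by simp)).comp hτ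
    have heq : ∀ s : ℝ, eS (x₀ + s • v) = eS x₀ + (S (x₀ + s • v) - S x₀) • v := fun s => by
      simp only [heS, map_add, map_smul, hl, smul_eq_mul, mul_one]
      module
    have hline : Tendsto (fun s : ℝ => eS (x₀ + s • v)) (𝓝 0) (𝓝 (eS x₀)) := by
      simp only [heq]
      simpa using tendsto_const_nhds.add (hτ.smul_const v)
    refine hτC.frequently ((hbl.and_eventually (hline.eventually hΨe)).mono ?_)
    rintro s ⟨hs, hse⟩
    rw [← toC_smul, ← toC_add, ← heq, hse, eS.symm_apply_apply, hB.2.2]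
    exact_mod_cast hs
  have hfreq : ∃ᶠ z in 𝓝 (toC x₀), z ∈ Z ∧ F z ≠ 0 := by
    intro hcon
    refine hZF ⟨_, hcon, ?_⟩
    rintro z ⟨hzZ, hz⟩
    refine ⟨⟨hZ.1 hzZ, ?_⟩, hz⟩
    by_contra hFz
    exact hz ⟨hzZ, hFz⟩
  obtain ⟨z, hz, hzZ⟩ := exists_seq_forall_of_frequently hfreq
  have hwlim : Tendsto (fun k => z k + (SC (z k) - lC (z k)) • toC v) atTop
      (𝓝 (toC (eS x₀))) := by
    have h1 : toC (eS x₀) = toC x₀ + (SC (toC x₀) - lC (toC x₀)) • toC v := by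
      rw [heS, toC_add, toC_smul, hSe, hlC]; push_cast; rfl
    rw [h1]
    exact ((hSC (toC x₀)).shear lC (toC v)).continuousAt.tendsto.comp hz
  have hclim : Tendsto (fun k => F (z k)) atTop (𝓝 0) := by
    have h1 : F (toC x₀) = 0 := by rw [hF.2.2, hx₀]; simp
    rw [← h1]
    exact (hFa x₀).continuousAt.tendsto.comp hz
  -- Here `w k` is the image of `z k` under the complexified `eS`, and `c k = F (z k)`.
  obtain ⟨t, ht, hk⟩ := exists_param_ne_zero hG hne hwlim hclim fun k => (hzZ k).2
  -- the perturbed shear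
  let R : RSpace n → ℝ := fun x => S x + t * f x
  let RC : CSpace n → ℂ := fun z => SC z + t * F z
  have hRC : ∀ x, AnalyticAt ℂ RC (toC x) := fun x =>
    (hSC _).add (analyticAt_const.mul (hFa x))
  have hRe : ∀ x, RC (toC x) = (R x : ℂ) := fun x => by
    simp only [RC, R, hSe, hF.2.2]; push_cast; rfl
  have hRd : Differentiable ℝ R := hSd.add (hfd.const_mul t)
  have hR1 : ∀ x, 1 ≤ fderiv ℝ R x v := by
    intro x
    rw [((hSd x).hasFDerivAt.fun_add ((hfd x).hasFDerivAt.const_mul t)).fderiv]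
    have h1 : |t * fderiv ℝ f x v| ≤ |fderiv ℝ f x v| := by
      rw [abs_mul, abs_of_nonneg ht.1]
      exact mul_le_of_le_one_left (abs_nonneg _) ht.2
    have h2 := neg_abs_le (t * fderiv ℝ f x v)
    simp only [FunLike.coe_add, FunLike.coe_smul, Pi.add_apply, Pi.smul_apply, smul_eq_mul]
    linarith [hSf x, abs_nonneg (fderiv ℝ f x v)]
  have hR0 : ∀ x, fderiv ℝ R x v ≠ 0 := fun x => (zero_lt_one.trans_le (hR1 x)).ne'
  let eR : RSpace n ≃ RSpace n := Equiv.ofBijective _ (bijective_shear hRd hR1 hl)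
  have heR : ∀ x, eR x = x + (R x - l x) • v := fun x => rfl
  let φ : RSpace n ≃ RSpace n := eR.trans eS.symm
  have hφgerm := exists_complex_germ_transition hRC hRe (fun x => hSC (toC x)) hSe hlC hl hS0
    eR eS heR heS
  have hφsgerm := exists_complex_germ_transition (fun x => hSC (toC x)) hSe hRC hRe hlC hl hR0
    eS eR heS heR
  have hφa : AnalyticOnNhd ℝ φ univ := fun x _ => by
    obtain ⟨Θ, h1, h2⟩ := hφgerm x
    exact analyticAt_of_complex_map h1 h2
  have hφsa : AnalyticOnNhd ℝ φ.symm univ := fun x _ => by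
    obtain ⟨Θ, h1, h2⟩ := hφsgerm x
    exact analyticAt_of_complex_map h1 h2
  have hφeq : ∀ x, φ x + (S (φ x) - l (φ x)) • v = x + (R x - l x) • v := fun x => by
    rw [← heS, ← heR]; exact eS.apply_symm_apply _
  have hSφ : ∀ x, S (φ x) = S x + t * f x := fun x => by
    have := congrArg l (hφeq x)
    simpa [hl] using this
  -- The displacement is read off by `l`, which makes it analytic in `x`.
  have hφσ : ∀ x, φ x = x + l (φ x - x) • v := fun x => by
    have h1 : φ x - x = ((R x - l x) - (S (φ x) - l (φ x))) • v := by
      rw [sub_smul, sub_eq_iff_eq_add, ← add_left_inj ((S (φ x) - l (φ x)) • v), hφeq x]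
      abel
    have h2 : l (φ x - x) = (R x - l x) - (S (φ x) - l (φ x)) := by
      rw [h1, map_smul, hl, smul_eq_mul, mul_one]
    rw [h2, ← h1]; abel
  have hσa : AnalyticOnNhd ℝ (fun x => l (φ x - x)) univ := fun x hx =>
    (l.analyticAt _).comp ((hφa x hx).sub analyticAt_id)
  obtain ⟨U, B₀, hU, hB₀a, hB₀e⟩ := exists_isHolomorphicExtension (h := b ∘ φ) fun a => by
    obtain ⟨Θ, h1, h2⟩ := hφgerm a
    refine ⟨fun z => B (Θ z), AnalyticAt.comp (g := B) ?_ h1, ?_⟩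
    · rw [h2.self_of_nhds]; exact hBa _
    · filter_upwards [h2] with x hx
      rw [hx, hB.2.2]; rfl
  refine ⟨φ, hφa, hφsa, exists_unit_of_shear hfa hSa hSf ht hσa hφσ hSφ, Ω ∩ U, B₀,
    inter_subset_left, ⟨⟨hΩ.1.inter hU.1, subset_inter hΩ.2 hU.2⟩,
      hB₀a.mono inter_subset_right, hB₀e⟩, ?_⟩
  rintro ⟨V, hV, hVsub⟩
  -- This uses `f x₀ = 0`: for every `t` the perturbed shear sends `x₀` to the point where the germ
  -- `Ψ` is given.
  have heR0 : eR x₀ = eS x₀ := by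
    simp only [heR, heS, R, hx₀, mul_zero, add_zero]
  have hRx : ∀ x, toC x + (RC (toC x) - lC (toC x)) • toC v = toC (eR x) := fun x => by
    rw [heR, toC_add, toC_smul, hRe, hlC]; push_cast; rfl
  have hcR : ContinuousAt eR x₀ :=
    (((analyticAt_of_complex (hRC x₀) (Eventually.of_forall hRe))).shear l v).continuousAt
  have hloc : B₀ =ᶠ[𝓝 (toC x₀)] fun z => B (Ψ (z + (RC z - lC z) • toC v)) := by
    refine eventuallyEq_of_eventuallyEq_real (hB₀a _ (hU.2 (mem_range_self x₀))) ?_ ?_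
    · refine AnalyticAt.comp (g := fun y => B (Ψ y)) ?_ ((hRC x₀).shear lC (toC v))
      rw [hRx, heR0]; exact hG
    · rw [← heR0] at hΨe
      filter_upwards [hcR.eventually hΨe] with x hx
      rw [hRx, hx, hB₀e, hB.2.2]; rfl
  obtain ⟨k, hk1, hk2, hk3⟩ :=
    (hk.and ((hz.eventually hloc).and (hz.eventually hV))).exists
  have hzero : B₀ (z k) = 0 := (hVsub ⟨(hzZ k).1, hk3⟩).1.2
  refine hk1 ?_
  rw [← hzero, hk2]
  simp only [RC]
  congr 2
  module
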